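/- Let $E$ be a Banach space over $\mathbb K\in\{\mathbb R,\mathbb C\}$, let $\Lambda\subset E$ be open, let $x_0\in\Lambda$, and let $\mathcal F=\{M(x)\}_{x\in\Lambda}$ be a family of linear subspaces of $E$, possibly infinite-dimensional. Definitions. The notation $E=A\oplus B$ means that $A,B$ are closed subspaces with $A\cap B=\{0\}$ and $A+B=E$; then $P_A^{B}$ denotes the projection of $E$ onto $A$ along $B$. A set $S\subset E$ is a $c^1$ submanifold if for each $x\in S$ there are a decomposition $E=E_0\oplus E_1$, an open neighbourhood $U$ of $x$ in $E$ and a $c^1$ diffeomorphism $\varphi$ of $U$ onto an open set $\varphi(U)\subset E$ such that $\varphi(S\cap U)$ is an open subset of $E_0$. The family $\mathcal F$ is $c^1$ integrable at $x_0$ if there is a $c^1$ submanifold $S\subset\Lambda$ of $E$ with $x_0\in S$ that is tangent to $M(x)$ at every $x\in S$, that is, $$M(x)=\{\dot c(0): c \text{ is a } c^1\text{ curve in } S,\ \text{defined on an open interval around } 0,\ \text{with } c(0)=x\}\qquad\text{for all }x\in S.$$ Write $M_0=M(x_0)$. If $E=M_0\oplus E_*$, the co-final set is $J(x_0,E_*)=\{x\in\Lambda: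 M(x)\oplus E_*=E\}$, and for $x\in J(x_0,E_*)$ the coordinate operator $\alpha(x)$ is the unique bounded operator $\alpha(x)\in B(M_0,E_*)$ with $M(x)=\{e+\alpha(x)e: e\in M_0\}$. Differentiability is in the Fréchet sense over $\mathbb K$, curves have a real parameter, and $B(M_0,E_*)$ carries the operator norm. Theorem 2.2 (Frobenius theorem). $\mathcal F$ is $c^1$ integrable at $x_0$ if and only if the following conditions hold: (i) $M_0$ splits in $E$, say $E=M_0\oplus E_*$ for some closed subspace $E_*$; (ii) for such an $E_*$ there are an open neighbourhood $V$ of $P_{M_0}^{E_*}x_0$ in $M_0$ and a $c^1$ map $\psi:V\to E_*$ such that $x+\psi(x)\in J(x_0,E_*)$ for all $x\in V$ and the map $x\mapsto\alpha(x+\psi(x))\in B(M_0,E_*)$ is continuous on $V$; (iii) $\psi$ satisfies $$\psi'(x)=\alpha(x+\psi(x))\quad\text{for all }x\in V,\qquad \psi(P_{M_0}^{E_*}x_0)=P_{E_*}^{M_0}x_0 .$$ Here (i)–(iii) are required jointly: there exist $E_*$, $V$ and $\psi$ with all these properties. -/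

import Mathlib

open Set

/-! Direct sums `p ⊕ q = E` of subspaces of a Banach space are topological direct sums,
`Submodule.IsTopCompl p q`; in a Banach space this says exactly that `p`, `q` are closed and
algebraically complementary (`Submodule.isTopCompl_iff_isCompl_isClosed`). -/

section Submanifolds

variable (𝕜 : Type*) [RCLike 𝕜] {E : Type*} [NormedAddCommGroup E] [NormedSpace 𝕜 E]

/-- `S` is a `C¹` submanifold of `E`: around each of its points there is a `C¹` diffeomorphism `φ`
between open subsets of `E` mapping the part of `S` in its domain onto an open subset of a
subspace `E₀` that splits in `E`. -/
def IsC1Submanifold (S : Set E) : Prop :=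
  ∀ x ∈ S, ∃ E₀ E₁ : Submodule 𝕜 E, E₀.IsTopCompl E₁ ∧
    ∃ φ : OpenPartialHomeomorph E E, x ∈ φ.source ∧
      ContDiffOn 𝕜 1 φ φ.source ∧ ContDiffOn 𝕜 1 φ.symm φ.target ∧
      ∃ W : Set E₀, IsOpen W ∧ φ '' (S ∩ φ.source) = (fun w : E₀ => (w : E)) '' W

/-- The set of velocities `c'(0)` of `C¹` curves `c` in `S` with `c(0) = x`. -/
def tangentVectors {E : Type*} [NormedAddCommGroup E] [NormedSpace ℝ E]
    (S : Set E) (x : E) : Set E :=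
  {v | ∃ c : ℝ → E, ∃ δ : ℝ, 0 < δ ∧ ContDiffOn ℝ 1 c (Ioo (-δ) δ) ∧
    (∀ t ∈ Ioo (-δ) δ, c t ∈ S) ∧ c 0 = x ∧ HasDerivAt c v 0}

/-- The family `M(x)`, `x ∈ Λ`, is `C¹` integrable at `x₀`: there is a `C¹` submanifold `S ⊆ Λ`
through `x₀` that is tangent to `M(x)` at each of its points `x`.
Only the values of `M` on `Λ` matter. -/
def C1IntegrableAt [NormedSpace ℝ E] (Λ : Set E) (M : E → Submodule 𝕜 E) (x₀ : E) : Prop :=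
  ∃ S : Set E, x₀ ∈ S ∧ S ⊆ Λ ∧ IsC1Submanifold 𝕜 S ∧
    ∀ x ∈ S, (M x : Set E) = tangentVectors S x

end Submanifolds

section Cofinal

variable {𝕜 : Type*} [RCLike 𝕜] {E : Type*} [NormedAddCommGroup E] [NormedSpace 𝕜 E]

/-- The co-final set `J(x₀, Es) = {x ∈ Λ : M(x) ⊕ Es = E}`
(used for a closed complement `Es` of `M(x₀)`). -/
def cofinalSet (Λ : Set E) (M : E → Submodule 𝕜 E) (Es : Submodule 𝕜 E) : Set E :=
  {x | x ∈ Λ ∧ (M x).IsTopCompl Es}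

/-- `α ∈ B(M₀, Es)` is the coordinate operator of `N`, i.e. `N = {e + α e : e ∈ M₀}`. -/
def IsCoordinateOperator (M₀ Es N : Submodule 𝕜 E) (α : M₀ →L[𝕜] Es) : Prop :=
  (N : Set E) = {v | ∃ e : M₀, v = (e : E) + (α e : E)}

/-- A common complement `Es` of `M₀` and `N` gives a unique coordinate operator of `N`. -/
theorem existsUnique_coordinateOperator {M₀ Es N : Submodule 𝕜 E}
    (h₀ : M₀.IsTopCompl Es) (h : N.IsTopCompl Es) :
    ∃! α : M₀ →L[𝕜] Es, IsCoordinateOperator M₀ Es N α := by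
  have key : ∀ (p : Submodule 𝕜 E) (hp : p.IsTopCompl Es) (v : E),
      (p.projectionOntoL Es hp v : E) + (Es.projectionOntoL p hp.symm v : E) = v := by
    intro p hp v
    simpa using Submodule.projection_add_projection_eq_self hp.isCompl v
  have disj : ∀ a ∈ M₀, ∀ b ∈ Es, ∀ a' ∈ M₀, ∀ b' ∈ Es, a + b = a' + b' → a = a' ∧ b = b' := by
    intro a ha b hb a' ha' b' hb' hab
    have h1 : a - a' = b' - b := by
      rw [sub_eq_sub_iff_add_eq_add, hab, add_comm]
    have h2 : a - a' ∈ Es := h1 ▸ Es.sub_mem hb' hb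
    have h3 : a - a' = 0 :=
      Submodule.disjoint_def.1 h₀.isCompl.disjoint _ (M₀.sub_mem ha ha') h2
    refine ⟨sub_eq_zero.1 h3, ?_⟩
    rw [h3] at h1
    exact (sub_eq_zero.1 h1.symm).symm
  refine ⟨-((Es.projectionOntoL N h.symm).comp M₀.subtypeL), ?_, ?_⟩
  · ext v
    simp only [SetLike.mem_coe, Set.mem_ofPred_eq]
    constructor
    · intro hv
      refine ⟨M₀.projectionOntoL Es h₀ v, ?_⟩
      have e1 := key M₀ h₀ v
      have e2 : Es.projectionOntoL N h.symm (M₀.projectionOntoL Es h₀ v : E)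
          = -(Es.projectionOntoL M₀ h₀.symm v) := by
        have : (M₀.projectionOntoL Es h₀ v : E) = v - (Es.projectionOntoL M₀ h₀.symm v : E) :=
          eq_sub_of_add_eq e1
        rw [this, map_sub, Submodule.projectionOntoL_apply_left,
          (Submodule.projectionOntoL_apply_eq_zero_iff h.symm).2 hv, zero_sub]
      simp only [neg_apply, ContinuousLinearMap.comp_apply,
        Submodule.subtypeL_apply, e2, neg_neg]
      exact e1.symm
    · rintro ⟨e, rfl⟩
      have e1 := key N h (e : E)
      have : (e : E) + ((-((Es.projectionOntoL N h.symm).comp M₀.subtypeL)) e : Es)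
          = (N.projectionOntoL Es h (e : E) : E) := by
        simp only [neg_apply, ContinuousLinearMap.comp_apply,
          Submodule.subtypeL_apply, Submodule.coe_neg]
        rw [← sub_eq_add_neg]
        exact sub_eq_of_eq_add e1.symm
      rw [this]
      exact Subtype.property _
  · intro β hβ
    ext e
    have hmem : (e : E) + (β e : E) ∈ N := by
      have : (e : E) + (β e : E) ∈ (N : Set E) := by
        rw [hβ]; exact ⟨e, rfl⟩
      exact this
    have h0 := (Submodule.projectionOntoL_apply_eq_zero_iff h.symm).2 hmem
    rw [map_add, Submodule.projectionOntoL_apply_left] at h0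
    have h1 : β e = -(Es.projectionOntoL N h.symm (e : E)) :=
      eq_neg_of_add_eq_zero_right h0
    simp [h1]

open Classical in
/-- The coordinate operator `α` of a subspace `N` relative to `E = M₀ ⊕ Es`: the unique
`α ∈ B(M₀, Es)` with `N = {e + α e : e ∈ M₀}`. It exists and is unique whenever `N ⊕ Es = E`;
the value `0` in the remaining cases is a placeholder. -/
noncomputable def coordinateOperator (M₀ Es N : Submodule 𝕜 E) : M₀ →L[𝕜] Es :=
  if h : ∃ α : M₀ →L[𝕜] Es, IsCoordinateOperator M₀ Es N α then h.choose else 0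

theorem coordinateOperator_eq_iff {M₀ Es N : Submodule 𝕜 E}
    (h₀ : M₀.IsTopCompl Es) (h : N.IsTopCompl Es) (α : M₀ →L[𝕜] Es) :
    coordinateOperator M₀ Es N = α ↔ IsCoordinateOperator M₀ Es N α := by
  have hu := existsUnique_coordinateOperator h₀ h
  have hs : IsCoordinateOperator M₀ Es N (coordinateOperator M₀ Es N) := by
    rw [coordinateOperator, dif_pos hu.exists]
    exact hu.exists.choose_spec
  exact ⟨fun e => e ▸ hs, fun hα => hu.unique hs hα⟩

end Cofinal

/-! Near a point, a submanifold `S` is the zero set of `z ↦ Q (φ z)`, where `φ` is a chart and `Q`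
the projection onto the complement of the model space. This map is a submersion whose derivative
has a bounded right inverse, so by the implicit function theorem `S` is the graph of a map `ψ` over
the kernel of that derivative, with `ψ' = 0` at the base point. The tangent space of a graph at
`y + ψ y` is `{e + ψ' y e}`: at the base point this identifies the kernel with `M x₀`, and at the
other points it turns tangency to `M` into the equation `ψ' = α`. Conversely, the shear
`z ↦ z - ψ (P z)`, with `P` the projection onto `M x₀`, flattens the graph of `ψ`, which is
therefore a submanifold. -/

open Filter Topology
open scoped ContDiff

section Tangent

variable {F G : Type*} [NormedAddCommGroup F] [NormedSpace ℝ F]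
  [NormedAddCommGroup G] [NormedSpace ℝ G]

theorem mem_tangentVectors_iff {S : Set F} {x v : F} :
    v ∈ tangentVectors S x ↔ ∃ c : ℝ → F, ContDiffAt ℝ 1 c 0 ∧ (∀ᶠ t in 𝓝 0, c t ∈ S) ∧
      c 0 = x ∧ HasDerivAt c v 0 := by
  constructor
  · rintro ⟨c, δ, hδ, hc, hcS, hc0, hcv⟩
    have hn : Ioo (-δ) δ ∈ 𝓝 (0 : ℝ) := Ioo_mem_nhds (neg_lt_zero.2 hδ) hδ
    exact ⟨c, hc.contDiffAt hn, mem_of_superset hn hcS, hc0, hcv⟩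
  · rintro ⟨c, hc, hcS, hc0, hcv⟩
    have hc' : ∀ᶠ t in 𝓝 (0 : ℝ), ContDiffAt ℝ 1 c t := hc.eventually (by decide)
    obtain ⟨δ, hδ, hball⟩ := Metric.eventually_nhds_iff_ball.1 (hc'.and hcS)
    rw [Real.ball_eq_Ioo, zero_sub, zero_add] at hball
    exact ⟨c, δ, hδ, fun t ht => (hball t ht).1.contDiffWithinAt, fun t ht => (hball t ht).2,
      hc0, hcv⟩

theorem tangentVectors_congr {S T : Set F} {x : F} (h : S =ᶠ[𝓝 x] T) :
    tangentVectors S x = tangentVectors T x := by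
  ext v
  rw [mem_tangentVectors_iff, mem_tangentVectors_iff]
  refine exists_congr fun c => and_congr_right fun hc => ?_
  rw [and_left_comm, and_left_comm (b := c 0 = x)]
  refine and_congr_right fun hc0 => and_congr_left fun _ => eventually_congr ?_
  exact (hc0 ▸ hc.continuousAt.tendsto).eventually h.mem_iff

theorem apply_mem_tangentVectors_range {f : F → G} {f' : F →L[ℝ] G} {x : F}
    (hf : ContDiffAt ℝ 1 f x) (hf' : HasFDerivAt f f' x) (v : F) :
    f' v ∈ tangentVectors (range f) (f x) := by
  have hline : HasDerivAt (fun t : ℝ => x + t • v) v 0 := by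
    simpa using ((hasDerivAt_id (0 : ℝ)).smul_const v).const_add x
  have hx : x + (0 : ℝ) • v = x := by rw [zero_smul, add_zero]
  rw [← hx] at hf hf'
  exact mem_tangentVectors_iff.2 ⟨fun t => f (x + t • v), hf.comp (0 : ℝ) (by fun_prop),
    Eventually.of_forall fun t => mem_range_self _, congrArg f hx, hf'.comp_hasDerivAt 0 hline⟩

end Tangent

section GraphMap

variable {R : Type*} [Ring R] {E : Type*} [AddCommGroup E] [Module R E] {p q : Submodule R E}

/-- The parametrization `y ↦ y + ψ y` of the graph of `ψ : p → q`, where the graph is regarded as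
a subset of the ambient space `E = p ⊕ q` rather than of `p × q`. -/
def graphMap (ψ : p → q) (y : p) : E := (y : E) + (ψ y : E)

variable [TopologicalSpace E]

theorem projectionOntoL_graphMap_left (h : p.IsTopCompl q) (ψ : p → q) (y : p) :
    p.projectionOntoL q h (graphMap ψ y) = y := by
  rw [graphMap, map_add, Submodule.projectionOntoL_apply_left,
    Submodule.projectionOntoL_apply_right, add_zero]

theorem mem_image_graphMap_iff (h : p.IsTopCompl q) {ψ : p → q} {V : Set p} {z : E} :
    z ∈ graphMap ψ '' V ↔
      p.projectionOntoL q h z ∈ V ∧ graphMap ψ (p.projectionOntoL q h z) = z := by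
  refine ⟨?_, fun hz => ⟨_, hz⟩⟩
  rintro ⟨y, hy, rfl⟩
  rw [projectionOntoL_graphMap_left]
  exact ⟨hy, rfl⟩

theorem mem_range_graphMap_iff (h : p.IsTopCompl q) {ψ : p → q} {z : E} :
    z ∈ range (graphMap ψ) ↔ graphMap ψ (p.projectionOntoL q h z) = z := by
  rw [← image_univ, mem_image_graphMap_iff h]
  exact and_iff_right (mem_univ _)

theorem image_graphMap_eventuallyEq_range (h : p.IsTopCompl q) (ψ : p → q) {V : Set p} {y : p}
    (hV : V ∈ 𝓝 y) : graphMap ψ '' V =ᶠ[𝓝 (graphMap ψ y)] range (graphMap ψ) := by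
  rw [← projectionOntoL_graphMap_left h ψ y] at hV
  filter_upwards [(p.projectionOntoL q h).continuous.continuousAt.eventually_mem hV] with z hz
  exact propext <| (mem_image_graphMap_iff h).trans <|
    (and_iff_right hz).trans (mem_range_graphMap_iff h).symm

variable [IsTopologicalAddGroup E]

theorem projectionOntoL_graphMap_right (h : p.IsTopCompl q) (ψ : p → q) (y : p) :
    q.projectionOntoL p h.symm (graphMap ψ y) = ψ y := by
  rw [graphMap, map_add, Submodule.projectionOntoL_apply_left,
    Submodule.projectionOntoL_apply_right, zero_add]

theorem graphMap_projectionOntoL_eq_iff (h : p.IsTopCompl q) {ψ : p → q} {z : E} :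
    graphMap ψ (p.projectionOntoL q h z) = z ↔
      ψ (p.projectionOntoL q h z) = q.projectionOntoL p h.symm z := by
  refine ⟨fun hz => ?_, fun hz => ?_⟩
  · rw [← projectionOntoL_graphMap_right h ψ, hz]
  · rw [graphMap, hz]
    exact Submodule.projection_add_projection_eq_self h.isCompl z

end GraphMap

section CoordinateOperator

variable {𝕜 : Type*} [RCLike 𝕜] {E : Type*} [NormedAddCommGroup E] [NormedSpace 𝕜 E]
  {p q N : Submodule 𝕜 E} {α : p →L[𝕜] q}

theorem IsCoordinateOperator.isTopCompl (hα : IsCoordinateOperator p q N α)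
    (h : p.IsTopCompl q) : N.IsTopCompl q := by
  have hN : N = (p.subtypeL + q.subtypeL.comp α).range := by
    refine SetLike.coe_injective (hα.trans ?_)
    ext v
    simp [eq_comm]
  have key := ContinuousLinearMap.isTopCompl_range_ker_of_leftInverse
    (p.subtypeL + q.subtypeL.comp α) (p.projectionOntoL q h) (projectionOntoL_graphMap_left h α)
  rwa [Submodule.ker_projectionOntoL, ← hN] at key

theorem IsCoordinateOperator.coordinateOperator_eq (hα : IsCoordinateOperator p q N α)
    (h : p.IsTopCompl q) : coordinateOperator p q N = α :=
  (coordinateOperator_eq_iff h (hα.isTopCompl h) α).2 hα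

end CoordinateOperator

section Graph

variable {𝕜 : Type*} [RCLike 𝕜] {E : Type*} [NormedAddCommGroup E] [NormedSpace 𝕜 E]
  {p q : Submodule 𝕜 E} {ψ : p → q} {V : Set p}

theorem contDiffAt_graphMap {n : ℕ∞ω} {y : p} (hψ : ContDiffAt 𝕜 n ψ y) :
    ContDiffAt 𝕜 n (graphMap ψ) y :=
  p.subtypeL.contDiff.contDiffAt.add (q.subtypeL.contDiff.contDiffAt.comp y hψ)

theorem hasFDerivAt_graphMap {y : p} {L : p →L[𝕜] q} (hL : HasFDerivAt ψ L y) :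
    HasFDerivAt (graphMap ψ) (p.subtypeL + q.subtypeL.comp L) y :=
  p.subtypeL.hasFDerivAt.add (q.subtypeL.hasFDerivAt.comp y hL)

/-- The shear `z ↦ z - ψ (P z)`, where `P` is the projection onto `p` along `q`. It flattens the
graph of `ψ` over `V` to `V ⊆ p`. -/
noncomputable def graphShear (h : p.IsTopCompl q) (hV : IsOpen V) (hψ : ContinuousOn ψ V) :
    OpenPartialHomeomorph E E where
  toFun z := z - ψ (p.projectionOntoL q h z)
  invFun z := z + ψ (p.projectionOntoL q h z)
  source := p.projectionOntoL q h ⁻¹' V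
  target := p.projectionOntoL q h ⁻¹' V
  map_source' z hz := by simpa using hz
  map_target' z hz := by simpa using hz
  left_inv' z _ := by simp
  right_inv' z _ := by simp
  open_source := hV.preimage (p.projectionOntoL q h).continuous
  open_target := hV.preimage (p.projectionOntoL q h).continuous
  continuousOn_toFun := continuousOn_id.sub <| continuous_subtype_val.comp_continuousOn <|
    hψ.comp (p.projectionOntoL q h).continuous.continuousOn (mapsTo_preimage _ _)
  continuousOn_invFun := continuousOn_id.add <| continuous_subtype_val.comp_continuousOn <|
    hψ.comp (p.projectionOntoL q h).continuous.continuousOn (mapsTo_preimage _ _)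

theorem graphShear_image_graph (h : p.IsTopCompl q) (hV : IsOpen V) (hψ : ContinuousOn ψ V) :
    graphShear h hV hψ '' (graphMap ψ '' V ∩ (graphShear h hV hψ).source) =
      (fun w : p => (w : E)) '' V := by
  have hsource : graphMap ψ '' V ⊆ (graphShear h hV hψ).source := fun z hz =>
    ((mem_image_graphMap_iff h).1 hz).1
  rw [inter_eq_self_of_subset_left hsource, image_image]
  refine image_congr fun y _ => ?_
  change graphMap ψ y - ψ (p.projectionOntoL q h (graphMap ψ y)) = (y : E)
  rw [projectionOntoL_graphMap_left, graphMap, add_sub_cancel_right]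

theorem isC1Submanifold_image_graphMap (h : p.IsTopCompl q) (hV : IsOpen V)
    (hψ : ContDiffOn 𝕜 1 ψ V) : IsC1Submanifold 𝕜 (graphMap ψ '' V) := by
  have hψP : ContDiffOn 𝕜 1 (fun z : E => (ψ (p.projectionOntoL q h z) : E))
      (p.projectionOntoL q h ⁻¹' V) :=
    q.subtypeL.contDiff.comp_contDiffOn
      (hψ.comp (p.projectionOntoL q h).contDiff.contDiffOn (mapsTo_preimage _ _))
  intro z hz
  exact ⟨p, q, h, graphShear h hV hψ.continuousOn, ((mem_image_graphMap_iff h).1 hz).1,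
    contDiffOn_id.sub hψP, contDiffOn_id.add hψP, V, hV,
    graphShear_image_graph h hV hψ.continuousOn⟩

variable [NormedSpace ℝ E] [IsScalarTower ℝ 𝕜 E]

theorem tangentVectors_range_graphMap (h : p.IsTopCompl q) {y : p} (hψ : ContDiffAt 𝕜 1 ψ y)
    {L : p →L[𝕜] q} (hL : HasFDerivAt ψ L y) :
    tangentVectors (range (graphMap ψ)) (graphMap ψ y) =
      {v | ∃ e : p, v = (e : E) + (L e : E)} := by
  have hG := (hasFDerivAt_graphMap hL).restrictScalars ℝ
  ext v
  constructor
  · intro hv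
    obtain ⟨c, -, hcS, hc0, hcv⟩ := mem_tangentVectors_iff.1 hv
    set P := p.projectionOntoL q h
    have hPc : HasDerivAt (fun t => P (c t)) (P v) 0 :=
      (P.restrictScalars ℝ).hasFDerivAt.comp_hasDerivAt 0 hcv
    have hPc0 : P (c 0) = y := by rw [hc0, projectionOntoL_graphMap_left]
    have hlift : (fun t => graphMap ψ (P (c t))) =ᶠ[𝓝 0] c :=
      hcS.mono fun t ht => (mem_range_graphMap_iff h).1 ht
    rw [← hPc0] at hG
    exact ⟨P v, hcv.unique ((hG.comp_hasDerivAt 0 hPc).congr_of_eventuallyEq hlift.symm)⟩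
  · rintro ⟨e, rfl⟩
    exact apply_mem_tangentVectors_range ((contDiffAt_graphMap hψ).restrict_scalars ℝ) hG e

theorem isCoordinateOperator_iff_eq_tangentVectors (h : p.IsTopCompl q) {N : Submodule 𝕜 E}
    {S : Set E} {y : p} (hS : S =ᶠ[𝓝 (graphMap ψ y)] range (graphMap ψ))
    (hψ : ContDiffAt 𝕜 1 ψ y) :
    IsCoordinateOperator p q N (fderiv 𝕜 ψ y) ↔
      (N : Set E) = tangentVectors S (graphMap ψ y) := by
  rw [tangentVectors_congr hS,
    tangentVectors_range_graphMap h hψ (hψ.differentiableAt one_ne_zero).hasFDerivAt]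
  rfl

end Graph

section LevelSet

/-- The data for the implicit function theorem at `x` which solves `f z = f x` for `z` in terms of
its component in the kernel of the derivative of `f`, along a complement `q` of that kernel. -/
noncomputable def kerImplicitFunctionData {𝕜 : Type*} [NontriviallyNormedField 𝕜]
    {E : Type*} [NormedAddCommGroup E] [NormedSpace 𝕜 E] [CompleteSpace E]
    {F : Type*} [NormedAddCommGroup F] [NormedSpace 𝕜 F] [CompleteSpace F]
    {f : E → F} {f' : E →L[𝕜] F} {x : E} (hf : HasStrictFDerivAt f f' x) (hsurj : f'.range = ⊤)
    {q : Submodule 𝕜 E} (h : f'.ker.IsTopCompl q) : ImplicitFunctionData 𝕜 E F f'.ker where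
  leftFun := f
  leftDeriv := f'
  rightFun := f'.ker.projectionOntoL q h
  rightDeriv := f'.ker.projectionOntoL q h
  pt := x
  hasStrictFDerivAt_leftFun := hf
  hasStrictFDerivAt_rightFun := (f'.ker.projectionOntoL q h).hasStrictFDerivAt
  range_leftDeriv := hsurj
  range_rightDeriv := Submodule.range_projectionOntoL h
  isCompl_ker := by
    rw [Submodule.ker_projectionOntoL h]
    exact h.isCompl

variable {𝕜 : Type*} [RCLike 𝕜] {E : Type*} [NormedAddCommGroup E] [NormedSpace 𝕜 E]
  [CompleteSpace E] {F : Type*} [NormedAddCommGroup F] [NormedSpace 𝕜 F] [CompleteSpace F]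

theorem exists_levelSet_eventuallyEq_graph {n : ℕ∞ω} (hn : n ≠ 0) {f : E → F} {f' : E →L[𝕜] F}
    {x : E} (hf : ContDiffAt 𝕜 n f x) (hf' : HasStrictFDerivAt f f' x) (hsurj : f'.range = ⊤)
    {q : Submodule 𝕜 E} (h : f'.ker.IsTopCompl q) :
    ∃ ψ : f'.ker → q, ContDiffAt 𝕜 n ψ (f'.ker.projectionOntoL q h x) ∧
      HasFDerivAt ψ (0 : f'.ker →L[𝕜] q) (f'.ker.projectionOntoL q h x) ∧
      f ⁻¹' {f x} =ᶠ[𝓝 x] range (graphMap ψ) := by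
  set P := f'.ker.projectionOntoL q h
  set Q := q.projectionOntoL f'.ker h.symm
  let data := kerImplicitFunctionData hf' hsurj h
  let g : f'.ker → E := data.implicitFunction (f x)
  have hg : ContDiffAt 𝕜 n g (P x) :=
    (data.contDiffAt_implicitFunction hf P.contDiff.contDiffAt hn).comp (P x)
      (contDiffAt_const.prodMk contDiffAt_id)
  have hg' : HasFDerivAt g f'.ker.subtypeL (P x) :=
    (data.hasStrictFDerivAt_implicitFunction f'.ker.subtypeL
      (ContinuousLinearMap.ext (Submodule.projectionOntoL_apply_left h))
      (ContinuousLinearMap.ext fun e => e.2)).hasFDerivAt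
  have hQ : Q.comp f'.ker.subtypeL = 0 :=
    ContinuousLinearMap.ext (Submodule.projectionOntoL_apply_right h.symm)
  refine ⟨fun y => Q (g y), Q.contDiff.contDiffAt.comp _ hg, hQ ▸ Q.hasFDerivAt.comp _ hg', ?_⟩
  rw [eventuallyEq_set]
  filter_upwards [data.leftFun_eq_iff_implicitFunction,
    data.rightFun_implicitFunction_eq_rightFun] with z hfz hPz
  replace hPz : P (g (P z)) = P z := hPz
  have hgz : graphMap (fun y => Q (g y)) (P z) = g (P z) := calc
    (P z : E) + Q (g (P z)) = P (g (P z)) + Q (g (P z)) := by rw [hPz]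
    _ = g (P z) := Submodule.projection_add_projection_eq_self h.isCompl _
  rw [mem_range_graphMap_iff h, hgz]
  exact hfz

end LevelSet

section Submanifold

theorem fderiv_comp_fderiv_of_eventually_right_inverse {𝕜 : Type*} [NontriviallyNormedField 𝕜]
    {E F : Type*} [NormedAddCommGroup E] [NormedSpace 𝕜 E] [NormedAddCommGroup F]
    [NormedSpace 𝕜 F] {f : E → F} {g : F → E} {y : F} (hf : DifferentiableAt 𝕜 f (g y))
    (hg : DifferentiableAt 𝕜 g y) (h : ∀ᶠ z in 𝓝 y, f (g z) = z) :
    (fderiv 𝕜 f (g y)).comp (fderiv 𝕜 g y) = ContinuousLinearMap.id 𝕜 F := by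
  rw [← fderiv_comp y hf hg]
  exact (EventuallyEq.fderiv_eq h).trans fderiv_id

variable {𝕜 : Type*} [RCLike 𝕜] {E : Type*} [NormedAddCommGroup E] [NormedSpace 𝕜 E]
  {S : Set E} {x : E}

theorem eventuallyEq_levelSet_of_chart {E₀ E₁ : Submodule 𝕜 E} (h : E₀.IsTopCompl E₁)
    {φ : OpenPartialHomeomorph E E} {W : Set E₀} (hW : IsOpen W)
    (hSW : φ '' (S ∩ φ.source) = (fun w : E₀ => (w : E)) '' W) (hxS : x ∈ S) (hx : x ∈ φ.source) :
    S =ᶠ[𝓝 x] (fun z => E₁.projectionOntoL E₀ h.symm (φ z)) ⁻¹'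
      {E₁.projectionOntoL E₀ h.symm (φ x)} := by
  have hS : ∀ z ∈ φ.source, z ∈ S ↔ ∃ w ∈ W, (w : E) = φ z := fun z hz => by
    change _ ↔ φ z ∈ (fun w : E₀ => (w : E)) '' W
    rw [← hSW]
    refine ⟨fun hzS => mem_image_of_mem φ ⟨hzS, hz⟩, ?_⟩
    rintro ⟨y, ⟨hyS, hy⟩, hyz⟩
    exact φ.injOn hy hz hyz ▸ hyS
  obtain ⟨w, hw, hwx⟩ := (hS x hx).1 hxS
  have hW' : ∀ᶠ z in 𝓝 x, E₀.projectionOntoL E₁ h (φ z) ∈ W := by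
    refine ((E₀.projectionOntoL E₁ h).continuous.continuousAt.comp
      (φ.continuousAt hx)).eventually_mem (hW.mem_nhds ?_)
    rwa [Function.comp_apply, ← hwx, Submodule.projectionOntoL_apply_left]
  rw [eventuallyEq_set]
  filter_upwards [φ.open_source.mem_nhds hx, hW'] with z hz hzW
  rw [hS z hz, mem_preimage, mem_singleton_iff, ← hwx, Submodule.projectionOntoL_apply_right,
    Submodule.projectionOntoL_apply_eq_zero_iff]
  refine ⟨fun ⟨w', _, hw'⟩ => hw' ▸ w'.2, fun hz₀ => ⟨⟨φ z, hz₀⟩, ?_, rfl⟩⟩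
  rwa [show φ z = ((⟨φ z, hz₀⟩ : E₀) : E) from rfl, Submodule.projectionOntoL_apply_left] at hzW

theorem IsC1Submanifold.exists_eventuallyEq_levelSet (hS : IsC1Submanifold 𝕜 S) (hx : x ∈ S) :
    ∃ q : Submodule 𝕜 E, IsClosed (q : Set E) ∧ ∃ (f : E → q) (B : q →L[𝕜] E),
      ContDiffAt 𝕜 1 f x ∧ Function.RightInverse B (fderiv 𝕜 f x) ∧ S =ᶠ[𝓝 x] f ⁻¹' {f x} := by
  obtain ⟨E₀, E₁, h, φ, hxφ, hφ, hφ', W, hW, hSW⟩ := hS x hx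
  set Q := E₁.projectionOntoL E₀ h.symm
  have hφx := φ.map_source hxφ
  have hcφ := hφ.contDiffAt (φ.open_source.mem_nhds hxφ)
  have hcφ' := hφ'.contDiffAt (φ.open_target.mem_nhds hφx)
  have hdφ : DifferentiableAt 𝕜 φ (φ.symm (φ x)) := by
    rw [φ.left_inv hxφ]
    exact hcφ.differentiableAt one_ne_zero
  have hinv := fderiv_comp_fderiv_of_eventually_right_inverse hdφ
    (hcφ'.differentiableAt one_ne_zero) (φ.eventually_right_inverse hφx)
  rw [φ.left_inv hxφ] at hinv
  refine ⟨E₁, h.symm.isClosed, fun z => Q (φ z), (fderiv 𝕜 φ.symm (φ x)).comp E₁.subtypeL,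
    Q.contDiff.contDiffAt.comp x hcφ, fun b => ?_, eventuallyEq_levelSet_of_chart h hW hSW hx hxφ⟩
  have hQφ : fderiv 𝕜 (fun z => Q (φ z)) x = Q.comp (fderiv 𝕜 φ x) :=
    (Q.hasFDerivAt.comp x (hcφ.differentiableAt one_ne_zero).hasFDerivAt).fderiv
  calc
    fderiv 𝕜 (fun z => Q (φ z)) x (fderiv 𝕜 φ.symm (φ x) b)
      = Q ((fderiv 𝕜 φ x).comp (fderiv 𝕜 φ.symm (φ x)) b) := by rw [hQφ]; rfl
    _ = Q b := by rw [hinv]; rfl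
    _ = b := Submodule.projectionOntoL_apply_left h.symm b

theorem IsC1Submanifold.exists_eventuallyEq_graph [CompleteSpace E] (hS : IsC1Submanifold 𝕜 S)
    (hx : x ∈ S) :
    ∃ (p q : Submodule 𝕜 E) (h : p.IsTopCompl q) (ψ : p → q),
      ContDiffAt 𝕜 1 ψ (p.projectionOntoL q h x) ∧
      HasFDerivAt ψ (0 : p →L[𝕜] q) (p.projectionOntoL q h x) ∧
      S =ᶠ[𝓝 x] range (graphMap ψ) := by
  obtain ⟨r, hr, f, B, hf, hB, hSf⟩ := hS.exists_eventuallyEq_levelSet hx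
  have := hr.completeSpace_coe
  obtain ⟨ψ, hψ, hψ', hfψ⟩ := exists_levelSet_eventuallyEq_graph one_ne_zero hf
    (hf.hasStrictFDerivAt one_ne_zero) (LinearMap.range_eq_top.2 hB.surjective)
    (ContinuousLinearMap.isTopCompl_range_ker_of_leftInverse B _ hB).symm
  exact ⟨_, _, _, ψ, hψ, hψ', hSf.trans hfψ⟩

theorem graphMap_projectionOntoL_of_mem_of_eventuallyEq {p q : Submodule 𝕜 E}
    (h : p.IsTopCompl q) {ψ : p → q} (hx : x ∈ S) (hS : S =ᶠ[𝓝 x] range (graphMap ψ)) :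
    graphMap ψ (p.projectionOntoL q h x) = x :=
  (mem_range_graphMap_iff h).1 (hS.mem_iff.self_of_nhds.1 hx)

theorem exists_isOpen_eventuallyEq_graph {p q : Submodule 𝕜 E} {ψ : p → q} {y : p} {n : ℕ}
    (hψ : ContDiffAt 𝕜 n ψ y) (hS : S =ᶠ[𝓝 (graphMap ψ y)] range (graphMap ψ)) :
    ∃ V : Set p, IsOpen V ∧ y ∈ V ∧ ContDiffOn 𝕜 n ψ V ∧
      ∀ z ∈ V, graphMap ψ z ∈ S ∧ S =ᶠ[𝓝 (graphMap ψ z)] range (graphMap ψ) := by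
  have hSy := (contDiffAt_graphMap hψ).continuousAt.eventually hS.eventuallyEq_nhds
  obtain ⟨V, hV, hVo, hyV⟩ := eventually_nhds_iff.1 ((hψ.eventually (by simp)).and hSy)
  exact ⟨V, hVo, hyV, fun z hz => (hV z hz).1.contDiffWithinAt, fun z hz =>
    ⟨(hV z hz).2.mem_iff.self_of_nhds.2 (mem_range_self z), (hV z hz).2⟩⟩

end Submanifold

section Frobenius

variable {𝕜 : Type*} [RCLike 𝕜] {E : Type*} [NormedAddCommGroup E] [NormedSpace 𝕜 E]
  [NormedSpace ℝ E] [IsScalarTower ℝ 𝕜 E] {Λ : Set E} {M : E → Submodule 𝕜 E} {x₀ : E}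

theorem C1IntegrableAt.exists_graph [CompleteSpace E] (hM : C1IntegrableAt 𝕜 Λ M x₀) :
    ∃ (q : Submodule 𝕜 E) (h : (M x₀).IsTopCompl q) (V : Set (M x₀)) (ψ : M x₀ → q),
      IsOpen V ∧ (M x₀).projectionOntoL q h x₀ ∈ V ∧ ContDiffOn 𝕜 1 ψ V ∧
      graphMap ψ ((M x₀).projectionOntoL q h x₀) = x₀ ∧
      ∀ y ∈ V, graphMap ψ y ∈ Λ ∧
        IsCoordinateOperator (M x₀) q (M (graphMap ψ y)) (fderiv 𝕜 ψ y) := by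
  obtain ⟨S, hx₀, hSΛ, hS, htangent⟩ := hM
  obtain ⟨p, q, h, ψ, hψ, hψ', hSψ⟩ := hS.exists_eventuallyEq_graph hx₀
  have hψx₀ := graphMap_projectionOntoL_of_mem_of_eventuallyEq h hx₀ hSψ
  rw [← hψx₀] at hSψ
  obtain rfl : M x₀ = p := SetLike.coe_injective <| by
    rw [htangent x₀ hx₀, ← hψx₀, tangentVectors_congr hSψ, tangentVectors_range_graphMap h hψ hψ']
    ext v
    simp
  obtain ⟨V, hV, hx₀V, hψV, hSV⟩ := exists_isOpen_eventuallyEq_graph hψ hSψ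
  refine ⟨q, h, V, ψ, hV, hx₀V, hψV, hψx₀, fun y hy => ⟨hSΛ (hSV y hy).1, ?_⟩⟩
  rw [isCoordinateOperator_iff_eq_tangentVectors h (hSV y hy).2
    (hψV.contDiffAt (hV.mem_nhds hy))]
  exact htangent _ (hSV y hy).1

theorem c1IntegrableAt_of_graph {p q : Submodule 𝕜 E} (h : p.IsTopCompl q) {V : Set p}
    (hV : IsOpen V) {ψ : p → q} (hψ : ContDiffOn 𝕜 1 ψ V)
    (hx₀ : x₀ ∈ graphMap ψ '' V) (hΛ : ∀ y ∈ V, graphMap ψ y ∈ Λ)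
    (hM : ∀ y ∈ V, IsCoordinateOperator p q (M (graphMap ψ y)) (fderiv 𝕜 ψ y)) :
    C1IntegrableAt 𝕜 Λ M x₀ := by
  refine ⟨graphMap ψ '' V, hx₀, image_subset_iff.2 hΛ, isC1Submanifold_image_graphMap h hV hψ, ?_⟩
  rintro _ ⟨y, hy, rfl⟩
  have hVy := hV.mem_nhds hy
  exact (isCoordinateOperator_iff_eq_tangentVectors h (image_graphMap_eventuallyEq_range h ψ hVy)
    (hψ.contDiffAt hVy)).1 (hM y hy)

end Frobenius

theorem theorem2p2_general {𝕜 : Type*} [RCLike 𝕜] {E : Type*} [NormedAddCommGroup E]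
    [NormedSpace 𝕜 E] [NormedSpace ℝ E] [IsScalarTower ℝ 𝕜 E] [CompleteSpace E]
    (Λ : Set E) (M : E → Submodule 𝕜 E) (x₀ : E) :
    C1IntegrableAt 𝕜 Λ M x₀ ↔
      ∃ (Es : Submodule 𝕜 E) (hEs : (M x₀).IsTopCompl Es)
        (V : Set (M x₀)) (ψ : M x₀ → Es),
        IsOpen V ∧ (M x₀).projectionOntoL Es hEs x₀ ∈ V ∧
        ContDiffOn 𝕜 1 ψ V ∧
        (∀ x ∈ V, (x : E) + (ψ x : E) ∈ cofinalSet Λ M Es) ∧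
        ContinuousOn
          (fun x : M x₀ => coordinateOperator (M x₀) Es (M ((x : E) + (ψ x : E)))) V ∧
        (∀ x ∈ V, HasFDerivAt ψ
          (coordinateOperator (M x₀) Es (M ((x : E) + (ψ x : E)))) x) ∧
        ψ ((M x₀).projectionOntoL Es hEs x₀) = Es.projectionOntoL (M x₀) hEs.symm x₀ := by
  constructor
  · intro hM
    obtain ⟨q, h, V, ψ, hV, hx₀V, hψ, hx₀, hα⟩ := hM.exists_graph
    have hαψ : ∀ y ∈ V, coordinateOperator (M x₀) q (M (graphMap ψ y)) = fderiv 𝕜 ψ y :=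
      fun y hy => (hα y hy).2.coordinateOperator_eq h
    have hψ' : ∀ y ∈ V, HasFDerivAt ψ (fderiv 𝕜 ψ y) y := fun y hy =>
      ((hψ.contDiffAt (hV.mem_nhds hy)).differentiableAt one_ne_zero).hasFDerivAt
    exact ⟨q, h, V, ψ, hV, hx₀V, hψ, fun y hy => ⟨(hα y hy).1, (hα y hy).2.isTopCompl h⟩,
      (hψ.continuousOn_fderiv_of_isOpen hV le_rfl).congr hαψ,
      fun y hy => (hψ' y hy).congr_fderiv (hαψ y hy).symm,
      (graphMap_projectionOntoL_eq_iff h).1 hx₀⟩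
  · rintro ⟨q, h, V, ψ, hV, hx₀V, hψ, hJ, -, hψ', hx₀⟩
    refine c1IntegrableAt_of_graph h hV hψ
      ⟨_, hx₀V, (graphMap_projectionOntoL_eq_iff h).2 hx₀⟩ (fun y hy => (hJ y hy).1)
      fun y hy => ?_
    rw [(hψ' y hy).fderiv]
    exact (coordinateOperator_eq_iff h (hJ y hy).2 _).1 rfl

theorem theorem2p2 {𝕜 : Type*} [RCLike 𝕜] {E : Type*} [NormedAddCommGroup E]
    [NormedSpace 𝕜 E] [NormedSpace ℝ E] [IsScalarTower ℝ 𝕜 E] [CompleteSpace E]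
    (Λ : Set E) (hΛ : IsOpen Λ) (M : E → Submodule 𝕜 E) (x₀ : E) (hx₀ : x₀ ∈ Λ) :
    C1IntegrableAt 𝕜 Λ M x₀ ↔
      ∃ (Es : Submodule 𝕜 E) (hEs : (M x₀).IsTopCompl Es)
        (V : Set (M x₀)) (ψ : M x₀ → Es),
        IsOpen V ∧ (M x₀).projectionOntoL Es hEs x₀ ∈ V ∧
        ContDiffOn 𝕜 1 ψ V ∧
        (∀ x ∈ V, (x : E) + (ψ x : E) ∈ cofinalSet Λ M Es) ∧
        ContinuousOn
          (fun x : M x₀ => coordinateOperator (M x₀) Es (M ((x : E) + (ψ x : E)))) V ∧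
        (∀ x ∈ V, HasFDerivAt ψ
          (coordinateOperator (M x₀) Es (M ((x : E) + (ψ x : E)))) x) ∧
        ψ ((M x₀).projectionOntoL Es hEs x₀) = Es.projectionOntoL (M x₀) hEs.symm x₀ :=
  theorem2p2_general Λ M x₀
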